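/- Let $q>1$ be a real number. For $z\in\mathbb{C}^{\star}=\mathbb{C}\setminus\{0\}$ let $$\Theta_q(z)=\sum_{n\in\mathbb{Z}}\frac{z^n}{q^{n(n-1)/2}},$$ and for $z\in\mathbb{C}$ let $$E_q(z)=\sum_{n\ge 0}\frac{z^n}{q^{n(n-1)/2}}.$$ Call $\alpha\in\mathbb{R}$ an admissible growth exponent of $E_q$ if there is $K>0$ such that $$|E_q(z)|\le K\exp\left(\frac{\log^2|z|}{2\log q}\right)|z|^{\alpha}\qquad\text{for all } z\in\mathbb{C}^{\star}.$$ Admissible growth exponents exist. Let $\alpha$ be any admissible growth exponent of $E_q$, let $\omega,z\in\mathbb{C}^{\star}$ with $\omega\neq z$, and let $d\in\mathbb{R}$ be such that $\arg(\omega/z)+d\neq\pm\pi$ modulo $2\pi$ (that is, $\arg(\omega/z)+d$ is not an odd multiple of $\pi$) and $$\left|\frac{\omega}{z}\right|>q^{\alpha-\frac12}.$$ Then, with $L_d=[0,\infty)e^{id}$, the following integral converges absolutely and $$\frac{z}{\omega-z}=\frac{q}{\log q}\int_{L_d}\frac{E_q(\xi)}{\Theta_q\left(q\frac{\omega\xi}{z}\right)}\,d\xi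 .$$ -/

import Mathlib

noncomputable section

/-- The Jacobi Theta function `Θ_q(z) = ∑_{n ∈ ℤ} z ^ n / q ^ (n(n-1)/2)`, for `q > 1`, `z ≠ 0`.
The integer `n(n-1)` is even, so the division in the exponent is exact. -/
def qTheta (q : ℝ) (z : ℂ) : ℂ :=
  ∑' n : ℤ, 1 / (q : ℂ) ^ (n * (n - 1) / 2) * z ^ n

/-- The entire function `E_q(z) = ∑_{n ≥ 0} z ^ n / q ^ (n(n-1)/2)`, for `q > 1`. -/
def qE (q : ℝ) (z : ℂ) : ℂ :=
  ∑' n : ℕ, 1 / (q : ℂ) ^ (n * (n - 1) / 2) * z ^ n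

/-- `α` is an admissible exponent for the growth of `E_q`: for some `K > 0`,
`|E_q(z)| ≤ K exp (log² |z| / (2 log q)) |z| ^ α` for all `z ≠ 0`.
(As `z → 0` the right-hand side tends to `+∞`, so the point `0` carries no condition.) -/
def IsGrowthExponent (q α : ℝ) : Prop :=
  ∃ K : ℝ, 0 < K ∧ ∀ z : ℂ, z ≠ 0 →
    ‖qE q z‖ ≤ K * Real.exp (Real.log ‖z‖ ^ 2 / (2 * Real.log q)) * ‖z‖ ^ α

/-- Absolute convergence of `∫_{L_d} f(ξ) dξ` along the ray `L_d = [0, ∞) e^{id}`,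
parametrized by `ξ = r e^{id}`. -/
def RayIntegrable (d : ℝ) (f : ℂ → ℂ) : Prop :=
  MeasureTheory.IntegrableOn
    (fun r : ℝ => f (r * Complex.exp (d * Complex.I)) * Complex.exp (d * Complex.I))
    (Set.Ioi 0)

/-- The integral `∫_{L_d} f(ξ) dξ` along the ray `L_d = [0, ∞) e^{id}`,
parametrized by `ξ = r e^{id}`. -/
def rayIntegral (d : ℝ) (f : ℂ → ℂ) : ℂ :=
  ∫ r in Set.Ioi (0 : ℝ),
    f (r * Complex.exp (d * Complex.I)) * Complex.exp (d * Complex.I)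

end

/-! By the Jacobi triple product `Θ_q` has no zeros off the negative half-line, so for `s` off that
half-line the function `g t = 1 / Θ_q (s q ^ t)` is continuous on `ℝ`. The functional equation of
`Θ_q` shows that `g (t - n)` is `g t` times the `n`-th term of the series of `Θ_q (s q ^ t)`; hence
the integer translates of `g` add up to `1`, that is, `∫ g = 1`. With `l = ω / z` and
`ξ = q ^ t e ^ (i d)`, the integrand `E_q ξ / Θ_q (q l ξ) dξ` is
`(log q / q) ∑_{n ≥ 1} l ^ (-n) g (t - n) dt` for `s = q l e ^ (i d)`, and integrating term by term
leaves a geometric series, which converges for `1 < |l|`. The condition on `α` guarantees `1 < |l|`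
because `1 / 2` is the least growth exponent: `|E_q z|` is at most the positive series
`Θ_q |z|`, whose functional equation makes `Θ_q (q ^ t) / q ^ ((t ^ 2 + t) / 2)` periodic in `t`,
and on the other side `E_q (q ^ n)` exceeds its `n`-th term `q ^ ((n ^ 2 + n) / 2)`. -/

open Filter Topology MeasureTheory Finset

section GaussBinom

/-- The Gaussian binomial coefficient `[n, k]_p`, defined by the `q`-analogue of Pascal's rule so
that it makes sense in every commutative semiring. -/
def gaussBinom {R : Type*} [CommSemiring R] (p : R) : ℕ → ℕ → R
  | _, 0 => 1
  | 0, _ + 1 => 0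
  | n + 1, k + 1 => gaussBinom p n k + p ^ (k + 1) * gaussBinom p n (k + 1)

/-- The finite `q`-Pochhammer symbol `(a; p)_n`, here with base `p`. -/
def qPochhammer {R : Type*} [CommRing R] (a p : R) (n : ℕ) : R :=
  ∏ k ∈ range n, (1 - a * p ^ k)

variable {R : Type*}

@[simp]
theorem gaussBinom_zero_right [CommSemiring R] (p : R) (n : ℕ) : gaussBinom p n 0 = 1 := by
  cases n <;> rfl

theorem gaussBinom_succ_succ [CommSemiring R] (p : R) (n k : ℕ) :
    gaussBinom p (n + 1) (k + 1) = gaussBinom p n k + p ^ (k + 1) * gaussBinom p n (k + 1) :=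
  rfl

theorem gaussBinom_eq_zero_of_lt [CommSemiring R] (p : R) {n k : ℕ} (h : n < k) :
    gaussBinom p n k = 0 := by
  induction n generalizing k with
  | zero => obtain ⟨k, rfl⟩ := Nat.exists_eq_succ_of_ne_zero h.ne'; rfl
  | succ n ih =>
    obtain ⟨k, rfl⟩ := Nat.exists_eq_succ_of_ne_zero (Nat.ne_zero_of_lt h)
    rw [Nat.succ_eq_add_one, gaussBinom_succ_succ, ih (by omega), ih (by omega), mul_zero,
      add_zero]

@[simp]
theorem gaussBinom_self [CommSemiring R] (p : R) (n : ℕ) : gaussBinom p n n = 1 := by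
  induction n with
  | zero => rfl
  | succ n ih => rw [gaussBinom_succ_succ, ih, gaussBinom_eq_zero_of_lt p n.lt_succ_self, mul_zero,
      add_zero]

theorem qPochhammer_add [CommRing R] (a p : R) (m n : ℕ) :
    qPochhammer a p (m + n) = qPochhammer a p m * qPochhammer (a * p ^ m) p n := by
  simp only [qPochhammer, prod_range_add, pow_add, mul_assoc]

theorem qPochhammer_one [CommRing R] (a p : R) : qPochhammer a p 1 = 1 - a := by
  simp [qPochhammer]

theorem qPochhammer_succ [CommRing R] (a p : R) (n : ℕ) :
    qPochhammer a p (n + 1) = qPochhammer a p n * (1 - a * p ^ n) := by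
  rw [qPochhammer_add, qPochhammer_one]

theorem qPochhammer_succ' [CommRing R] (a p : R) (n : ℕ) :
    qPochhammer a p (n + 1) = (1 - a) * qPochhammer (a * p) p n := by
  rw [add_comm, qPochhammer_add, qPochhammer_one, pow_one]

theorem qPochhammer_neg_eq_sum_gaussBinom [CommRing R] (x p : R) (n : ℕ) :
    qPochhammer (-x) p n =
      ∑ k ∈ range (n + 1), gaussBinom p n k * (p ^ k.choose 2 * x ^ k) := by
  induction n generalizing x with
  | zero => simp [qPochhammer]
  | succ n ih =>
    let c (x : R) (k : ℕ) : R := gaussBinom p n k * (p ^ k.choose 2 * x ^ k)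
    have step (k : ℕ) : x * c (x * p) k + c (x * p) (k + 1) =
        gaussBinom p (n + 1) (k + 1) * (p ^ (k + 1).choose 2 * x ^ (k + 1)) := by
      simp only [c, gaussBinom_succ_succ, Nat.choose_succ_succ' k 1, Nat.choose_one_right]
      ring
    have last : c (x * p) (n + 1) = 0 := by
      simp only [c, gaussBinom_eq_zero_of_lt p n.lt_succ_self, zero_mul]
    calc qPochhammer (-x) p (n + 1)
        = (1 + x) * qPochhammer (-(x * p)) p n := by
          rw [qPochhammer_succ', sub_neg_eq_add, neg_mul]
      _ = x * ∑ k ∈ range (n + 1), c (x * p) k + ∑ k ∈ range (n + 1 + 1), c (x * p) k := by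
          rw [ih, sum_range_succ _ (n + 1), last]
          ring
      _ = ∑ k ∈ range (n + 1), (x * c (x * p) k + c (x * p) (k + 1)) + c (x * p) 0 := by
          rw [sum_range_succ' _ (n + 1), mul_sum, sum_add_distrib, add_assoc]
      _ = ∑ k ∈ range (n + 1 + 1), gaussBinom p (n + 1) k * (p ^ k.choose 2 * x ^ k) := by
          rw [sum_range_succ' _ (n + 1), sum_congr rfl fun k _ => step k]
          simp [c]

theorem gaussBinom_mul_qPochhammer [CommRing R] (p : R) (a b : ℕ) :
    gaussBinom p (a + b) a * (qPochhammer p p a * qPochhammer p p b) =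
      qPochhammer p p (a + b) := by
  induction a generalizing b with
  | zero => simp [qPochhammer]
  | succ a iha =>
    induction b with
    | zero => simp [qPochhammer]
    | succ b ihb =>
      rw [← add_assoc, gaussBinom_succ_succ, qPochhammer_succ p p (a + 1 + b)]
      have left := iha (b + 1)
      rw [← add_assoc, add_right_comm] at left
      rw [qPochhammer_succ p p b] at left ⊢
      rw [qPochhammer_succ p p a] at ihb ⊢
      linear_combination (1 - p * p ^ a) * left + p ^ (a + 1) * (1 - p * p ^ b) * ihb

end GaussBinom

section QPochhammerInf

/-- The infinite `q`-Pochhammer symbol `(a; p)_∞`, meaningful for `‖p‖ < 1`. -/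
noncomputable def qPochhammerInf {𝕜 : Type*} [NormedField 𝕜] (a p : 𝕜) : 𝕜 :=
  ∏' k : ℕ, (1 - a * p ^ k)

variable {𝕜 : Type*} [NormedField 𝕜] {p : 𝕜}

theorem summable_norm_neg_mul_pow (a : 𝕜) (hp : ‖p‖ < 1) :
    Summable fun k : ℕ => ‖-(a * p ^ k)‖ := by
  simp only [norm_neg, norm_mul, norm_pow]
  exact (summable_geometric_of_lt_one (norm_nonneg p) hp).mul_left _

theorem mul_pow_self_ne_one (hp : ‖p‖ < 1) (k : ℕ) : p * p ^ k ≠ 1 := by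
  intro h
  have : ‖p ^ (k + 1)‖ < 1 := norm_pow p (k + 1) ▸ pow_lt_one₀ (norm_nonneg p) hp k.succ_ne_zero
  rw [pow_succ', h, norm_one] at this
  exact this.false

theorem qPochhammer_self_ne_zero (hp : ‖p‖ < 1) (n : ℕ) : qPochhammer p p n ≠ 0 :=
  prod_ne_zero_iff.2 fun k _ => sub_ne_zero.2 (mul_pow_self_ne_one hp k).symm

theorem gaussBinom_add_left_eq_div (hp : ‖p‖ < 1) (a b : ℕ) :
    gaussBinom p (a + b) a = qPochhammer p p (a + b) / (qPochhammer p p a * qPochhammer p p b) :=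
  eq_div_of_mul_eq (mul_ne_zero (qPochhammer_self_ne_zero hp a) (qPochhammer_self_ne_zero hp b))
    (gaussBinom_mul_qPochhammer p a b)

variable [CompleteSpace 𝕜]

theorem tendsto_qPochhammer (a : 𝕜) (hp : ‖p‖ < 1) :
    Tendsto (qPochhammer a p) atTop (𝓝 (qPochhammerInf a p)) := by
  simpa only [← sub_eq_add_neg] using!
    (multipliable_one_add_of_summable
      (summable_norm_neg_mul_pow a hp)).hasProd.tendsto_prod_nat

theorem qPochhammerInf_ne_zero {a : 𝕜} (hp : ‖p‖ < 1) (ha : ∀ k : ℕ, a * p ^ k ≠ 1) :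
    qPochhammerInf a p ≠ 0 := by
  simpa only [← sub_eq_add_neg] using!
    tprod_one_add_ne_zero_of_summable (f := fun k : ℕ => -(a * p ^ k))
      (fun k => by simpa only [← sub_eq_add_neg] using sub_ne_zero.2 (ha k).symm)
      (summable_norm_neg_mul_pow a hp)

theorem qPochhammerInf_self_ne_zero (hp : ‖p‖ < 1) : qPochhammerInf p p ≠ 0 :=
  qPochhammerInf_ne_zero hp (mul_pow_self_ne_one hp)

theorem exists_norm_gaussBinom_le (hp : ‖p‖ < 1) :
    ∃ C, ∀ n k : ℕ, ‖gaussBinom p n k‖ ≤ C := by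
  have lim := tendsto_qPochhammer p hp
  obtain ⟨A, hA⟩ := (Metric.isBounded_range_of_tendsto _ lim).exists_norm_le
  obtain ⟨B, hB⟩ := (Metric.isBounded_range_of_tendsto _
    (lim.inv₀ (qPochhammerInf_self_ne_zero hp))).exists_norm_le
  simp only [Set.forall_mem_range] at hA hB
  have hA0 : 0 ≤ A := (norm_nonneg _).trans (hA 0)
  have hB0 : 0 ≤ B := (norm_nonneg _).trans (hB 0)
  refine ⟨A * (B * B), fun n k => ?_⟩
  rcases lt_or_ge n k with h | h
  · rw [gaussBinom_eq_zero_of_lt p h, norm_zero]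
    positivity
  · obtain ⟨l, rfl⟩ := Nat.exists_eq_add_of_le h
    rw [gaussBinom_add_left_eq_div hp, div_eq_mul_inv, mul_inv, norm_mul, norm_mul]
    gcongr
    exacts [hA _, hB _, hB _]

theorem tendsto_gaussBinom_central (hp : ‖p‖ < 1) (j : ℤ) :
    Tendsto (fun N : ℕ => gaussBinom p (2 * N) (N + j).toNat) atTop (𝓝 (qPochhammerInf p p)⁻¹) := by
  have lim {u : ℕ → ℕ} (hu : ∀ n, n - j.natAbs ≤ u n) :
      Tendsto (fun N => qPochhammer p p (u N)) atTop (𝓝 (qPochhammerInf p p)) :=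
    (tendsto_qPochhammer p hp).comp
      (tendsto_atTop_mono hu (tendsto_sub_atTop_nat _))
  have hne := qPochhammerInf_self_ne_zero hp
  have quot := (lim (u := fun N => 2 * N) fun N => by omega).div
    ((lim (u := fun N => (N + j).toNat) fun N => by omega).mul
      (lim (u := fun N => (N - j).toNat) fun N => by omega)) (mul_ne_zero hne hne)
  rw [div_mul_cancel_left₀ hne] at quot
  refine quot.congr' ((eventually_ge_atTop j.natAbs).mono fun N hN => ?_)
  have split : 2 * N = (N + j).toNat + (N - j).toNat := by omega
  simp only [Pi.div_apply, split, gaussBinom_add_left_eq_div hp]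

end QPochhammerInf

section ThetaTerm

/-- The general term `p ^ (n(n-1)/2) * z ^ n` of the theta series with nome `p`. The integer
`n(n-1)` is even, so the division in the exponent is exact. -/
def thetaTerm {K : Type*} [Field K] (p z : K) (n : ℤ) : K :=
  p ^ (n * (n - 1) / 2) * z ^ n

variable {K : Type*} [Field K] {p z : K}

theorem thetaTerm_natCast (p z : K) (n : ℕ) : thetaTerm p z n = p ^ n.choose 2 * z ^ n := by
  have exponent : (n : ℤ) * (n - 1) / 2 = (n.choose 2 : ℕ) := by
    rcases n with _ | n
    · rfl
    · rw [Nat.choose_two_right]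
      push_cast
      simp
  rw [thetaTerm, exponent, zpow_natCast, zpow_natCast]

theorem thetaTerm_zero (p z : K) : thetaTerm p z 0 = 1 := by simp [thetaTerm]

theorem thetaTerm_mul (p c z : K) (n : ℤ) : thetaTerm p (c * z) n = c ^ n * thetaTerm p z n := by
  rw [thetaTerm, thetaTerm, mul_zpow]
  ring

theorem thetaTerm_ne_zero (hp : p ≠ 0) (hz : z ≠ 0) (n : ℤ) : thetaTerm p z n ≠ 0 :=
  mul_ne_zero (zpow_ne_zero _ hp) (zpow_ne_zero _ hz)

theorem thetaTerm_zpow_mul (hp : p ≠ 0) (hz : z ≠ 0) (k n : ℤ) :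
    thetaTerm p (p ^ k * z) n * thetaTerm p z k = thetaTerm p z (n + k) := by
  have exponent : (n + k) * (n + k - 1) / 2 = n * (n - 1) / 2 + k * n + k * (k - 1) / 2 := by
    have hn := Int.ediv_mul_cancel (Int.even_mul_pred_self n).two_dvd
    have hk := Int.ediv_mul_cancel (Int.even_mul_pred_self k).two_dvd
    refine Int.ediv_eq_of_eq_mul_left two_ne_zero ?_
    linear_combination -hn - hk
  rw [thetaTerm_mul, thetaTerm, thetaTerm, thetaTerm, exponent, zpow_add₀ hp, zpow_add₀ hp,
    zpow_add₀ hz, ← zpow_mul]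
  ring

theorem thetaTerm_add_one (hp : p ≠ 0) (hz : z ≠ 0) (n : ℤ) :
    thetaTerm p z (n + 1) = p ^ n * z * thetaTerm p z n := by
  rw [add_comm, ← thetaTerm_zpow_mul hp hz]
  simp [thetaTerm]

theorem thetaTerm_neg (hp : p ≠ 0) (z : K) (n : ℤ) :
    thetaTerm p z (-n) = thetaTerm p (p * z⁻¹) n := by
  have exponent : -n * (-n - 1) / 2 = n * (n - 1) / 2 + n := by
    rw [← Int.add_mul_ediv_right _ _ two_ne_zero]
    ring_nf
  rw [thetaTerm, thetaTerm, exponent, zpow_add₀ hp, mul_zpow, inv_zpow', mul_assoc]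

theorem qPochhammer_neg_zpow_mul_mul_thetaTerm (hp : p ≠ 0) (hz : z ≠ 0) (N : ℕ) :
    qPochhammer (-(p ^ (-N : ℤ) * z)) p N * thetaTerm p z (-N) = qPochhammer (-(z⁻¹ * p)) p N := by
  induction N with
  | zero => simp [qPochhammer, thetaTerm_zero]
  | succ N ih =>
    have head : qPochhammer (-(p ^ (-(N + 1 : ℕ) : ℤ) * z)) p (N + 1) =
        (1 + p ^ (-(N + 1 : ℕ) : ℤ) * z) * qPochhammer (-(p ^ (-N : ℤ) * z)) p N := by
      rw [qPochhammer_succ', sub_neg_eq_add, neg_mul, mul_right_comm, ← zpow_add_one₀ hp]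
      congr 5
      push_cast
      ring
    have term := thetaTerm_add_one hp hz (-(N + 1 : ℕ))
    rw [show (-(N + 1 : ℕ) + 1 : ℤ) = -N by push_cast; ring] at term
    rw [head, qPochhammer_succ, ← ih, term]
    simp only [zpow_neg, zpow_natCast]
    field_simp
    ring

/-- The finite form of the Jacobi triple product. -/
theorem qPochhammer_mul_qPochhammer_eq_sum_thetaTerm (hp : p ≠ 0) (hz : z ≠ 0) (N : ℕ) :
    qPochhammer (-z) p N * qPochhammer (-(z⁻¹ * p)) p N =
      ∑ j ∈ Icc (-N : ℤ) N, gaussBinom p (2 * N) (N + j).toNat * thetaTerm p z j := by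
  have shift : -(p ^ (-N : ℤ) * z) * p ^ N = -z := by
    rw [zpow_neg, zpow_natCast]
    field_simp
  calc qPochhammer (-z) p N * qPochhammer (-(z⁻¹ * p)) p N
      = qPochhammer (-(p ^ (-N : ℤ) * z)) p (2 * N) * thetaTerm p z (-N) := by
        rw [two_mul, qPochhammer_add, shift, ← qPochhammer_neg_zpow_mul_mul_thetaTerm hp hz]
        ring
    _ = ∑ k ∈ range (2 * N + 1), gaussBinom p (2 * N) k * thetaTerm p z (k + -N) := by
        rw [qPochhammer_neg_eq_sum_gaussBinom, sum_mul]
        refine sum_congr rfl fun k _ => ?_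
        rw [← thetaTerm_zpow_mul hp hz, thetaTerm_natCast, mul_assoc]
    _ = ∑ j ∈ Icc (-N : ℤ) N, gaussBinom p (2 * N) (N + j).toNat * thetaTerm p z j := by
        refine sum_bij' (fun k _ => (k : ℤ) + -N) (fun j _ => (N + j).toNat) ?_ ?_ ?_ ?_ ?_
        · intro k hk
          simp only [mem_range, mem_Icc] at hk ⊢
          omega
        · intro j hj
          simp only [mem_range, mem_Icc] at hj ⊢
          omega
        · intro k _
          simp
        · intro j hj
          simp only [mem_Icc] at hj
          omega
        · intro k _
          simp

end ThetaTerm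

section ThetaSeries

/-- The theta series `∑ p ^ (n(n-1)/2) z ^ n` over the integers `n`, meaningful for `0 < ‖p‖ < 1`
and `z ≠ 0`. -/
noncomputable def thetaSeries {𝕜 : Type*} [NormedField 𝕜] (p z : 𝕜) : 𝕜 :=
  ∑' n : ℤ, thetaTerm p z n

variable {𝕜 : Type*} [NormedField 𝕜] {p z : 𝕜}

theorem norm_thetaTerm (p z : 𝕜) (n : ℤ) : ‖thetaTerm p z n‖ = thetaTerm ‖p‖ ‖z‖ n := by
  simp only [thetaTerm, norm_mul, norm_zpow]

theorem zpow_le_zpow_add_zpow {a b x : ℝ} (ha : 0 < a) (hax : a ≤ x) (hxb : x ≤ b) (n : ℤ) :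
    x ^ n ≤ a ^ n + b ^ n := by
  have hx : 0 < x := ha.trans_le hax
  have hb : 0 < b := hx.trans_le hxb
  rcases le_total 0 n with hn | hn
  · exact (zpow_le_zpow_left₀ hn hx.le hxb).trans (le_add_of_nonneg_left (zpow_pos ha n).le)
  · have : x ^ n ≤ a ^ n := by
      simpa only [inv_zpow', neg_neg] using
        zpow_le_zpow_left₀ (neg_nonneg.2 hn) (inv_pos.2 hx).le (inv_anti₀ ha hax)
    exact this.trans (le_add_of_nonneg_right (zpow_pos hb n).le)

theorem thetaTerm_nonneg {p z : ℝ} (hp : 0 ≤ p) (hz : 0 ≤ z) (n : ℤ) : 0 ≤ thetaTerm p z n :=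
  mul_nonneg (zpow_nonneg hp _) (zpow_nonneg hz _)

theorem norm_thetaTerm_le (p : 𝕜) {a b : ℝ} (ha : 0 < a) (haz : a ≤ ‖z‖) (hzb : ‖z‖ ≤ b) (n : ℤ) :
    ‖thetaTerm p z n‖ ≤ thetaTerm ‖p‖ a n + thetaTerm ‖p‖ b n := by
  rw [norm_thetaTerm, thetaTerm, thetaTerm, thetaTerm, ← mul_add]
  gcongr
  exact zpow_le_zpow_add_zpow ha haz hzb n

theorem thetaSeries_zpow_mul (hp : p ≠ 0) (hz : z ≠ 0) (k : ℤ) :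
    thetaSeries p (p ^ k * z) * thetaTerm p z k = thetaSeries p z := by
  rw [thetaSeries, thetaSeries, ← tsum_mul_right, ← (Equiv.addRight k).tsum_eq (thetaTerm p z)]
  exact tsum_congr fun n => thetaTerm_zpow_mul hp hz k n

theorem summable_norm_thetaTerm_natCast (hp : p ≠ 0) (hp1 : ‖p‖ < 1) (hz : z ≠ 0) :
    Summable fun n : ℕ => ‖thetaTerm p z n‖ := by
  refine summable_of_ratio_test_tendsto_lt_one zero_lt_one
    (Eventually.of_forall fun n => norm_ne_zero_iff.2 (thetaTerm_ne_zero hp hz n)) ?_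
  have ratio (n : ℕ) : ‖‖thetaTerm p z (n + 1 : ℕ)‖‖ / ‖‖thetaTerm p z n‖‖ = ‖p‖ ^ n * ‖z‖ := by
    have := norm_ne_zero_iff.2 (thetaTerm_ne_zero hp hz n)
    rw [norm_norm, norm_norm, Nat.cast_succ, thetaTerm_add_one hp hz, norm_mul,
      mul_div_cancel_right₀ _ this, norm_mul, zpow_natCast, norm_pow]
  simpa only [ratio, zero_mul] using
    (tendsto_pow_atTop_nhds_zero_of_lt_one (norm_nonneg p) hp1).mul_const ‖z‖

theorem summable_norm_thetaTerm (hp : p ≠ 0) (hp1 : ‖p‖ < 1) (hz : z ≠ 0) :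
    Summable fun n : ℤ => ‖thetaTerm p z n‖ := by
  refine Summable.of_nat_of_neg (summable_norm_thetaTerm_natCast hp hp1 hz) ?_
  simpa only [thetaTerm_neg hp] using
    summable_norm_thetaTerm_natCast hp hp1 (mul_ne_zero hp (inv_ne_zero hz))

theorem summable_thetaTerm_norm (hp : p ≠ 0) (hp1 : ‖p‖ < 1) {r : ℝ} (hr : 0 < r) :
    Summable fun n : ℤ => thetaTerm ‖p‖ r n := by
  refine .of_norm (summable_norm_thetaTerm (norm_ne_zero_iff.2 hp) ?_ hr.ne')
  rwa [norm_norm]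

variable [CompleteSpace 𝕜]

theorem continuousOn_thetaSeries (hp : p ≠ 0) (hp1 : ‖p‖ < 1) :
    ContinuousOn (thetaSeries p) {0}ᶜ := by
  intro z hz
  have hz : 0 < ‖z‖ := norm_pos_iff.2 hz
  have annulus : ContinuousOn (thetaSeries p) {w | ‖w‖ ∈ Set.Icc (‖z‖ / 2) (2 * ‖z‖)} := by
    refine continuousOn_tsum (fun n w hw => ?_)
      ((summable_thetaTerm_norm hp hp1 (half_pos hz)).add
        (summable_thetaTerm_norm hp hp1 (mul_pos two_pos hz)))
      fun n w hw => norm_thetaTerm_le p (half_pos hz) hw.1 hw.2 n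
    have hw0 : w ≠ 0 := norm_pos_iff.1 ((half_pos hz).trans_le hw.1)
    exact (continuousAt_const.mul (continuousAt_zpow₀ _ _ (Or.inl hw0))).continuousWithinAt
  refine (annulus.continuousAt ?_).continuousWithinAt
  exact continuous_norm.continuousAt (Icc_mem_nhds (half_lt_self hz) (by linarith))

/-- The **Jacobi triple product**. -/
theorem thetaSeries_eq_qPochhammerInf_mul (hp : p ≠ 0) (hp1 : ‖p‖ < 1) (hz : z ≠ 0) :
    thetaSeries p z =
      qPochhammerInf p p * (qPochhammerInf (-z) p * qPochhammerInf (-(z⁻¹ * p)) p) := by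
  let partialTerm (N : ℕ) : ℤ → 𝕜 := (Icc (-N : ℤ) N : Set ℤ).indicator
    fun j => gaussBinom p (2 * N) (N + j).toNat * thetaTerm p z j
  have finite (N : ℕ) :
      ∑' j, partialTerm N j = qPochhammer (-z) p N * qPochhammer (-(z⁻¹ * p)) p N := by
    rw [qPochhammer_mul_qPochhammer_eq_sum_thetaTerm hp hz, sum_eq_tsum_indicator]
  have termwise (j : ℤ) : Tendsto (partialTerm · j) atTop
      (𝓝 ((qPochhammerInf p p)⁻¹ * thetaTerm p z j)) := by
    have inside {N : ℕ} (hN : j.natAbs ≤ N) :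
        partialTerm N j = gaussBinom p (2 * N) (N + j).toNat * thetaTerm p z j := by
      have hj : j ∈ Icc (-N : ℤ) N := mem_Icc.2 (by omega)
      exact Set.indicator_of_mem (mem_coe.2 hj) _
    exact ((tendsto_gaussBinom_central hp1 j).mul_const _).congr'
      ((eventually_ge_atTop j.natAbs).mono fun N hN => (inside hN).symm)
  obtain ⟨C, hC⟩ := exists_norm_gaussBinom_le hp1
  have dominated (N : ℕ) (j : ℤ) : ‖partialTerm N j‖ ≤ C * ‖thetaTerm p z j‖ := by
    refine (norm_indicator_le_norm_self _ _).trans ?_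
    rw [norm_mul]
    gcongr
    exact hC _ _
  have limit : Tendsto (fun N => ∑' j, partialTerm N j) atTop
      (𝓝 (∑' j, (qPochhammerInf p p)⁻¹ * thetaTerm p z j)) :=
    tendsto_tsum_of_dominated_convergence
      ((summable_norm_thetaTerm hp hp1 hz).mul_left C) termwise (.of_forall dominated)
  rw [tsum_mul_left] at limit
  rw [← tendsto_nhds_unique (limit.congr finite)
      ((tendsto_qPochhammer _ hp1).mul (tendsto_qPochhammer _ hp1)),
    mul_inv_cancel_left₀ (qPochhammerInf_self_ne_zero hp1), thetaSeries]

theorem thetaSeries_ne_zero (hp : p ≠ 0) (hp1 : ‖p‖ < 1) (hz : z ≠ 0)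
    (h : ∀ k : ℤ, z ≠ -p ^ k) : thetaSeries p z ≠ 0 := by
  rw [thetaSeries_eq_qPochhammerInf_mul hp hp1 hz]
  refine mul_ne_zero (qPochhammerInf_self_ne_zero hp1)
    (mul_ne_zero (qPochhammerInf_ne_zero hp1 fun k hk => h (-k) ?_)
      (qPochhammerInf_ne_zero hp1 fun k hk => h (k + 1) ?_))
  · rw [zpow_neg, zpow_natCast]
    field_simp
    linear_combination -hk
  · rw [zpow_add_one₀ hp, zpow_natCast]
    field_simp at hk
    linear_combination -hk

end ThetaSeries

theorem integrable_tsum_of_summable_integral_norm {α ι E : Type*} [MeasurableSpace α]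
    [NormedAddCommGroup E] [CompleteSpace E] {μ : Measure α} [Countable ι] {f : ι → α → E}
    (hf : ∀ i, Integrable (f i) μ) (hsum : Summable fun i => ∫ a, ‖f i a‖ ∂μ) :
    Integrable (fun a => ∑' i, f i a) μ := by
  have finite : ∑' i, ‖(hf i).toL1 (f i)‖ₑ ≠ ⊤ := by
    rw [tsum_enorm_ne_top_iff_summable_norm]
    simpa only [L1.norm_of_fun_eq_integral_norm] using hsum
  refine (L1.integrable_coeFn (∑' i, (hf i).toL1 (f i))).congr ?_
  filter_upwards [Lp.coeFn_tsum finite, ae_all_iff.2 fun i => (hf i).coeFn_toL1] with a hsum_a ha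
  rw [hsum_a, tsum_congr ha]

section SumOfTranslates

variable {ι 𝕜 : Type*} [RCLike 𝕜] {g : ℝ → 𝕜} {a : ι → 𝕜}

theorem summable_integral_norm_mul_comp_sub (ha : Summable fun i => ‖a i‖) (g : ℝ → 𝕜)
    (x : ι → ℝ) : Summable fun i => ∫ t, ‖a i * g (t - x i)‖ := by
  have integral_norm (i : ι) : ∫ t, ‖a i * g (t - x i)‖ = ‖a i‖ * ∫ t, ‖g t‖ := by
    simp only [norm_mul, integral_const_mul, integral_sub_right_eq_self fun t => ‖g t‖]
  simpa only [integral_norm] using ha.mul_right _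

variable [Countable ι]

theorem integrable_tsum_mul_comp_sub (hg : Integrable g) (ha : Summable fun i => ‖a i‖)
    (x : ι → ℝ) : Integrable fun t => ∑' i, a i * g (t - x i) :=
  integrable_tsum_of_summable_integral_norm (fun i => (hg.comp_sub_right (x i)).const_mul (a i))
    (summable_integral_norm_mul_comp_sub ha g x)

theorem integral_tsum_mul_comp_sub (hg : Integrable g) (ha : Summable fun i => ‖a i‖)
    (x : ι → ℝ) : ∫ t, ∑' i, a i * g (t - x i) = (∑' i, a i) * ∫ t, g t := by
  rw [← integral_tsum_of_summable_integral_norm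
    (fun i => (hg.comp_sub_right (x i)).const_mul (a i))
    (summable_integral_norm_mul_comp_sub ha g x), ← tsum_mul_right]
  exact tsum_congr fun i => by rw [integral_const_mul, integral_sub_right_eq_self]

end SumOfTranslates

section IntegerTranslates

variable {E : Type*} [NormedAddCommGroup E]

theorem integrable_of_norm_comp_add_intCast_le {f : ℝ → E} (hf : Continuous f) {u : ℤ → ℝ}
    (hu : Summable u) (h : ∀ k : ℤ, ∀ t ∈ Set.Icc (0 : ℝ) 1, ‖f (t + k)‖ ≤ u k) :
    Integrable f := by
  refine Real.integrable_of_summable_norm_Icc (f := ⟨f, hf⟩)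
    (hu.of_nonneg_of_le (fun k => norm_nonneg _) fun k => ?_)
  have hk : 0 ≤ u k := (norm_nonneg _).trans (h k 0 (Set.left_mem_Icc.2 zero_le_one))
  exact (ContinuousMap.norm_le _ hk).2 fun t => h k t t.2

variable [NormedSpace ℝ E] [CompleteSpace E]

theorem integral_eq_of_hasSum_comp_add_intCast {f : ℝ → E} {c : E} (hf : Integrable f)
    (h : ∀ t : ℝ, HasSum (fun k : ℤ => f (t + k)) c) : ∫ t, f t = c := by
  have norms := hf.norm.hasSum_intervalIntegral_comp_add_int.summable
  simp only [intervalIntegral.integral_of_le zero_le_one] at norms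
  have swap := hasSum_integral_of_summable_integral_norm
    (fun k : ℤ => (hf.comp_add_right (k : ℝ)).integrableOn (s := Set.Ioc 0 1)) norms
  have total := hf.hasSum_intervalIntegral_comp_add_int
  simp only [intervalIntegral.integral_of_le zero_le_one] at total
  simpa [(h _).tsum_eq] using total.unique swap

end IntegerTranslates

section QTheta

variable {q : ℝ} {z : ℂ}

theorem inv_ofReal_ne_zero (hq : 1 < q) : (q : ℂ)⁻¹ ≠ 0 :=
  inv_ne_zero (Complex.ofReal_ne_zero.2 (zero_lt_one.trans hq).ne')

theorem norm_inv_ofReal (hq : 1 < q) : ‖(q : ℂ)⁻¹‖ = q⁻¹ := by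
  rw [norm_inv, Complex.norm_of_nonneg (zero_lt_one.trans hq).le]

theorem norm_inv_ofReal_lt_one (hq : 1 < q) : ‖(q : ℂ)⁻¹‖ < 1 :=
  (norm_inv_ofReal hq).trans_lt (inv_lt_one_of_one_lt₀ hq)

theorem qTheta_eq_thetaSeries (q : ℝ) : qTheta q = thetaSeries (q : ℂ)⁻¹ :=
  funext fun z => tsum_congr fun n => by rw [thetaTerm, inv_zpow, one_div]

theorem qE_eq_tsum_thetaTerm (q : ℝ) (z : ℂ) : qE q z = ∑' n : ℕ, thetaTerm (q : ℂ)⁻¹ z n :=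
  tsum_congr fun n => by rw [thetaTerm_natCast, Nat.choose_two_right, inv_pow, one_div]

theorem qTheta_ne_zero (hq : 1 < q) (hz : z ∈ Complex.slitPlane) : qTheta q z ≠ 0 := by
  rw [qTheta_eq_thetaSeries]
  refine thetaSeries_ne_zero (inv_ofReal_ne_zero hq) (norm_inv_ofReal_lt_one hq)
    (Complex.slitPlane_ne_zero hz) fun k hk => ?_
  have negative : -(q⁻¹ ^ k) ≤ 0 := neg_nonpos.2 (zpow_nonneg (by positivity) k)
  refine negative.not_gt (Complex.ofReal_mem_slitPlane.1 ?_)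
  push_cast
  rwa [← hk]

theorem continuousOn_qTheta (hq : 1 < q) : ContinuousOn (qTheta q) {0}ᶜ := by
  rw [qTheta_eq_thetaSeries]
  exact continuousOn_thetaSeries (inv_ofReal_ne_zero hq) (norm_inv_ofReal_lt_one hq)

end QTheta

section ThetaKernel

/-- The function `t ↦ 1 / Θ_q(s q ^ t)`: the reciprocal of `Θ_q` along the half-line through `s`, in
the logarithmic coordinate that turns multiplication by `q` into an integer translation. -/
noncomputable def thetaKernel (q : ℝ) (s : ℂ) (t : ℝ) : ℂ :=
  (qTheta q (s * (q ^ t : ℝ)))⁻¹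

variable {q : ℝ} {s : ℂ}

theorem mul_rpow_mem_slitPlane (hq : 1 < q) (hs : s ∈ Complex.slitPlane) (t : ℝ) :
    s * (q ^ t : ℝ) ∈ Complex.slitPlane := by
  have hpos : 0 < q ^ t := Real.rpow_pos_of_pos (zero_lt_one.trans hq) t
  rw [mul_comm, Complex.mem_slitPlane_iff_arg, Complex.arg_real_mul s hpos]
  exact ⟨Complex.slitPlane_arg_ne_pi hs,
    mul_ne_zero (Complex.ofReal_ne_zero.2 hpos.ne') (Complex.slitPlane_ne_zero hs)⟩

theorem mul_rpow_sub_intCast (hq : 0 < q) (s : ℂ) (t : ℝ) (k : ℤ) :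
    s * (q ^ (t - k) : ℝ) = (q : ℂ)⁻¹ ^ k * (s * (q ^ t : ℝ)) := by
  rw [Real.rpow_sub hq, Real.rpow_intCast]
  push_cast
  rw [inv_zpow]
  ring

theorem continuous_thetaKernel (hq : 1 < q) (hs : s ∈ Complex.slitPlane) :
    Continuous (thetaKernel q s) := by
  have hray : Continuous fun t : ℝ => s * (q ^ t : ℝ) :=
    continuous_const.mul (Complex.continuous_ofReal.comp
      (Real.continuous_const_rpow (zero_lt_one.trans hq).ne'))
  exact ((continuousOn_qTheta hq).comp_continuous hray fun t =>
    Complex.slitPlane_ne_zero (mul_rpow_mem_slitPlane hq hs t)).inv₀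
    fun t => qTheta_ne_zero hq (mul_rpow_mem_slitPlane hq hs t)

theorem thetaKernel_sub_intCast (hq : 1 < q) (hs : s ∈ Complex.slitPlane) (t : ℝ) (k : ℤ) :
    thetaKernel q s (t - k) = thetaTerm (q : ℂ)⁻¹ (s * (q ^ t : ℝ)) k * thetaKernel q s t := by
  have hw := Complex.slitPlane_ne_zero (mul_rpow_mem_slitPlane hq hs t)
  rw [thetaKernel, thetaKernel, mul_rpow_sub_intCast (zero_lt_one.trans hq), qTheta_eq_thetaSeries,
    ← thetaSeries_zpow_mul (inv_ofReal_ne_zero hq) hw k, mul_inv_rev,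
    mul_inv_cancel_left₀ (thetaTerm_ne_zero (inv_ofReal_ne_zero hq) hw k)]

theorem hasSum_thetaKernel_add_intCast (hq : 1 < q) (hs : s ∈ Complex.slitPlane) (t : ℝ) :
    HasSum (fun k : ℤ => thetaKernel q s (t + k)) 1 := by
  have hw := mul_rpow_mem_slitPlane hq hs t
  have series := (summable_norm_thetaTerm (inv_ofReal_ne_zero hq) (norm_inv_ofReal_lt_one hq)
    (Complex.slitPlane_ne_zero hw)).of_norm.hasSum.mul_right (thetaKernel q s t)
  have total : (∑' k, thetaTerm (q : ℂ)⁻¹ (s * (q ^ t : ℝ)) k) * thetaKernel q s t = 1 := by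
    rw [← thetaSeries, ← qTheta_eq_thetaSeries, thetaKernel,
      mul_inv_cancel₀ (qTheta_ne_zero hq hw)]
  simp only [total, ← thetaKernel_sub_intCast hq hs] at series
  simpa only [Function.comp_def, Equiv.neg_apply, Int.cast_neg, sub_neg_eq_add] using
    (Equiv.neg ℤ).hasSum_iff.2 series

theorem norm_thetaKernel_sub_intCast_le (hq : 1 < q) (hs : s ∈ Complex.slitPlane) {t : ℝ}
    (ht : t ∈ Set.Icc (0 : ℝ) 1) (k : ℤ) :
    ‖thetaKernel q s (t - k)‖ ≤
      (thetaTerm q⁻¹ ‖s‖ k + thetaTerm q⁻¹ (‖s‖ * q) k) * ‖thetaKernel q s t‖ := by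
  have hs0 : 0 < ‖s‖ := norm_pos_iff.2 (Complex.slitPlane_ne_zero hs)
  have hw : ‖s * (q ^ t : ℝ)‖ = ‖s‖ * q ^ t := by
    rw [norm_mul, Complex.norm_of_nonneg (Real.rpow_nonneg (zero_lt_one.trans hq).le t)]
  rw [thetaKernel_sub_intCast hq hs, norm_mul, ← norm_inv_ofReal hq]
  gcongr
  refine norm_thetaTerm_le _ hs0 ?_ ?_ k <;> rw [hw]
  · exact le_mul_of_one_le_right hs0.le (Real.one_le_rpow hq.le ht.1)
  · gcongr
    exact (Real.rpow_le_rpow_of_exponent_le hq.le ht.2).trans_eq (Real.rpow_one q)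

theorem integrable_thetaKernel (hq : 1 < q) (hs : s ∈ Complex.slitPlane) :
    Integrable (thetaKernel q s) := by
  have cont := continuous_thetaKernel hq hs
  obtain ⟨M, hM⟩ := isCompact_Icc.exists_bound_of_continuousOn
    (cont.continuousOn (s := Set.Icc (0 : ℝ) 1))
  have summable {r : ℝ} (hr : 0 < r) : Summable fun k : ℤ => thetaTerm q⁻¹ r (-k) := by
    have := summable_thetaTerm_norm (inv_ofReal_ne_zero hq) (norm_inv_ofReal_lt_one hq) hr
    rw [norm_inv_ofReal hq] at this
    exact (Equiv.neg ℤ).summable_iff.2 this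
  have hs0 : 0 < ‖s‖ := norm_pos_iff.2 (Complex.slitPlane_ne_zero hs)
  refine integrable_of_norm_comp_add_intCast_le cont (((summable hs0).add
    (summable (mul_pos hs0 (zero_lt_one.trans hq)))).mul_right M) fun k t ht => ?_
  have bound := norm_thetaKernel_sub_intCast_le hq hs ht (-k)
  rw [Int.cast_neg, sub_neg_eq_add] at bound
  refine bound.trans ?_
  gcongr
  · have hq0 : 0 ≤ q := (zero_lt_one.trans hq).le
    exact add_nonneg (thetaTerm_nonneg (inv_nonneg.2 hq0) hs0.le _)
      (thetaTerm_nonneg (inv_nonneg.2 hq0) (mul_nonneg hs0.le hq0) _)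
  · exact hM t ht

theorem integral_thetaKernel (hq : 1 < q) (hs : s ∈ Complex.slitPlane) :
    ∫ t, thetaKernel q s t = 1 :=
  integral_eq_of_hasSum_comp_add_intCast (integrable_thetaKernel hq hs)
    (hasSum_thetaKernel_add_intCast hq hs)

theorem mul_qE_div_qTheta_eq_tsum (hq : 1 < q) (hs : s ∈ Complex.slitPlane) (c : ℂ) (t : ℝ) :
    (q : ℂ)⁻¹ * c * (s * (q ^ t : ℝ)) *
        (qE q ((q : ℂ)⁻¹ * c * (s * (q ^ t : ℝ))) / qTheta q (s * (q ^ t : ℝ))) =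
      ∑' n : ℕ, (q : ℂ)⁻¹ * c ^ (n + 1) * thetaKernel q s (t - (n + 1 : ℕ)) := by
  have hw := Complex.slitPlane_ne_zero (mul_rpow_mem_slitPlane hq hs t)
  rw [qE_eq_tsum_thetaTerm, div_eq_mul_inv, ← thetaKernel, ← mul_assoc, ← tsum_mul_left,
    ← tsum_mul_right]
  refine tsum_congr fun n => ?_
  have translate := thetaKernel_sub_intCast hq hs t (n + 1 : ℕ)
  rw [Nat.cast_succ, thetaTerm_add_one (inv_ofReal_ne_zero hq) hw] at translate
  push_cast at translate ⊢
  rw [translate, thetaTerm_mul, mul_zpow, zpow_natCast, zpow_natCast]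
  ring

end ThetaKernel

section Ray

variable {E : Type*} [NormedAddCommGroup E] [NormedSpace ℝ E] {b : ℝ}

theorem image_const_rpow_univ (hb : 1 < b) : (fun t : ℝ => b ^ t) '' Set.univ = Set.Ioi 0 := by
  rw [Set.image_univ]
  refine Set.Subset.antisymm ?_ fun r hr => ⟨Real.logb b r, ?_⟩
  · rintro _ ⟨t, rfl⟩
    exact Real.rpow_pos_of_pos (zero_lt_one.trans hb) t
  · exact Real.rpow_logb (zero_lt_one.trans hb) hb.ne' hr

theorem hasDerivWithinAt_const_rpow (hb : 0 < b) (t : ℝ) (S : Set ℝ) :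
    HasDerivWithinAt (fun t : ℝ => b ^ t) (b ^ t * Real.log b) S t :=
  (Real.hasStrictDerivAt_const_rpow hb t).hasDerivAt.hasDerivWithinAt

theorem injOn_const_rpow (hb : 1 < b) : Set.InjOn (fun t : ℝ => b ^ t) Set.univ :=
  (Real.strictMono_rpow_of_base_gt_one hb).injective.injOn

theorem abs_rpow_mul_log_smul (hb : 1 < b) (t : ℝ) (v : E) :
    |b ^ t * Real.log b| • v = Real.log b • b ^ t • v := by
  rw [abs_of_pos (mul_pos (Real.rpow_pos_of_pos (zero_lt_one.trans hb) t) (Real.log_pos hb)),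
    mul_comm, mul_smul]

theorem integrableOn_Ioi_iff_integrable_rpow_smul (hb : 1 < b) (f : ℝ → E) :
    IntegrableOn f (Set.Ioi 0) ↔ Integrable fun t : ℝ => b ^ t • f (b ^ t) := by
  rw [← image_const_rpow_univ hb, integrableOn_image_iff_integrableOn_abs_deriv_smul
    MeasurableSet.univ (fun t _ => hasDerivWithinAt_const_rpow (zero_lt_one.trans hb) t _)
    (injOn_const_rpow hb),
    integrableOn_univ]
  simp only [abs_rpow_mul_log_smul hb]
  exact integrable_smul_iff (Real.log_pos hb).ne' _

theorem integral_Ioi_eq_log_smul_integral_rpow_smul (hb : 1 < b) (f : ℝ → E) :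
    ∫ r in Set.Ioi 0, f r = Real.log b • ∫ t : ℝ, b ^ t • f (b ^ t) := by
  rw [← image_const_rpow_univ hb, integral_image_eq_integral_abs_deriv_smul
    MeasurableSet.univ (fun t _ => hasDerivWithinAt_const_rpow (zero_lt_one.trans hb) t _)
    (injOn_const_rpow hb),
    setIntegral_univ]
  simp only [abs_rpow_mul_log_smul hb, integral_smul]

theorem rayIntegrable_iff_integrable_rpow (hb : 1 < b) (d : ℝ) (f : ℂ → ℂ) :
    RayIntegrable d f ↔ Integrable fun t : ℝ =>
      (b ^ t : ℝ) * Complex.exp (d * Complex.I) *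
        f ((b ^ t : ℝ) * Complex.exp (d * Complex.I)) := by
  rw [RayIntegrable, integrableOn_Ioi_iff_integrable_rpow_smul hb]
  simp only [Complex.real_smul, mul_comm (f _), mul_assoc]

theorem rayIntegral_eq_log_mul_integral_rpow (hb : 1 < b) (d : ℝ) (f : ℂ → ℂ) :
    rayIntegral d f = Real.log b * ∫ t : ℝ,
      (b ^ t : ℝ) * Complex.exp (d * Complex.I) *
        f ((b ^ t : ℝ) * Complex.exp (d * Complex.I)) := by
  rw [rayIntegral, integral_Ioi_eq_log_smul_integral_rpow_smul hb, Complex.real_smul]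
  simp only [Complex.real_smul, mul_comm (f _), mul_assoc]

theorem mul_exp_mem_slitPlane {v : ℂ} (hv : v ≠ 0) {d : ℝ}
    (hd : ∀ k : ℤ, v.arg + d ≠ (2 * k + 1) * Real.pi) :
    v * Complex.exp (d * Complex.I) ∈ Complex.slitPlane := by
  have hexp := Complex.exp_ne_zero (d * Complex.I)
  refine Complex.mem_slitPlane_iff_arg.2 ⟨fun harg => ?_, mul_ne_zero hv hexp⟩
  have angle : ((v.arg + d : ℝ) : Real.Angle) = Real.pi := by
    rw [← harg, Complex.arg_mul_coe_angle hv hexp, Complex.arg_exp_mul_I,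
      Real.Angle.coe_toIocMod, Real.Angle.coe_add]
  obtain ⟨k, hk⟩ := Real.Angle.angle_eq_iff_two_pi_dvd_sub.1 angle
  exact hd k (by linear_combination hk)

end Ray

section RayIntegral

variable {q : ℝ} {l : ℂ} {d : ℝ}

theorem rpow_mul_exp_mul_eq_tsum_thetaKernel (hq : 1 < q) (hl : l ≠ 0)
    (hs : q * l * Complex.exp (d * Complex.I) ∈ Complex.slitPlane) (t : ℝ) :
    (q ^ t : ℝ) * Complex.exp (d * Complex.I) *
        (qE q ((q ^ t : ℝ) * Complex.exp (d * Complex.I)) /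
          qTheta q (q * (l * ((q ^ t : ℝ) * Complex.exp (d * Complex.I))))) =
      ∑' n : ℕ, (q : ℂ)⁻¹ * l⁻¹ ^ (n + 1) *
        thetaKernel q (q * l * Complex.exp (d * Complex.I)) (t - (n + 1 : ℕ)) := by
  have hq0 : (q : ℂ) ≠ 0 := Complex.ofReal_ne_zero.2 (zero_lt_one.trans hq).ne'
  rw [← mul_qE_div_qTheta_eq_tsum hq hs]
  have point : (q : ℂ)⁻¹ * l⁻¹ * (q * l * Complex.exp (d * Complex.I) * (q ^ t : ℝ)) =
      (q ^ t : ℝ) * Complex.exp (d * Complex.I) := by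
    field_simp
  rw [point]
  ring_nf

theorem summable_norm_mul_pow_succ {c : ℂ} (a : ℂ) (hc : ‖c‖ < 1) :
    Summable fun n : ℕ => ‖a * c ^ (n + 1)‖ := by
  simp only [norm_mul, norm_pow, pow_succ]
  exact ((summable_geometric_of_lt_one (norm_nonneg c) hc).mul_right _).mul_left _

theorem tsum_inv_pow_succ (hl : 1 < ‖l‖) : ∑' n : ℕ, l⁻¹ ^ (n + 1) = (l - 1)⁻¹ := by
  have hl0 : l ≠ 0 := norm_pos_iff.1 (zero_lt_one.trans hl)
  simp only [pow_succ]
  rw [tsum_mul_right, tsum_geometric_of_norm_lt_one (norm_inv l ▸ inv_lt_one_of_one_lt₀ hl),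
    ← mul_inv]
  congr 1
  field_simp

theorem rayIntegrable_qE_div_qTheta (hq : 1 < q) (hl : 1 < ‖l‖)
    (hs : q * l * Complex.exp (d * Complex.I) ∈ Complex.slitPlane) :
    RayIntegrable d fun ξ => qE q ξ / qTheta q (q * (l * ξ)) := by
  simp only [rayIntegrable_iff_integrable_rpow hq,
    rpow_mul_exp_mul_eq_tsum_thetaKernel hq (norm_pos_iff.1 (zero_lt_one.trans hl)) hs]
  exact integrable_tsum_mul_comp_sub (integrable_thetaKernel hq hs)
    (summable_norm_mul_pow_succ _ (norm_inv l ▸ inv_lt_one_of_one_lt₀ hl)) _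

theorem rayIntegral_qE_div_qTheta (hq : 1 < q) (hl : 1 < ‖l‖)
    (hs : q * l * Complex.exp (d * Complex.I) ∈ Complex.slitPlane) :
    rayIntegral d (fun ξ => qE q ξ / qTheta q (q * (l * ξ))) =
      Real.log q * ((q : ℂ)⁻¹ * (l - 1)⁻¹) := by
  simp only [rayIntegral_eq_log_mul_integral_rpow hq,
    rpow_mul_exp_mul_eq_tsum_thetaKernel hq (norm_pos_iff.1 (zero_lt_one.trans hl)) hs]
  rw [integral_tsum_mul_comp_sub (integrable_thetaKernel hq hs)
    (summable_norm_mul_pow_succ _ (norm_inv l ▸ inv_lt_one_of_one_lt₀ hl)),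
    integral_thetaKernel hq hs, mul_one, tsum_mul_left, tsum_inv_pow_succ hl]

end RayIntegral

section GrowthExponent

variable {q : ℝ}

theorem norm_qE_le_thetaSeries (hq : 1 < q) {z : ℂ} (hz : z ≠ 0) :
    ‖qE q z‖ ≤ thetaSeries q⁻¹ ‖z‖ := by
  have hp := inv_ofReal_ne_zero hq
  have norm_term (n : ℤ) : ‖thetaTerm (q : ℂ)⁻¹ z n‖ = thetaTerm q⁻¹ ‖z‖ n := by
    rw [norm_thetaTerm, norm_inv_ofReal hq]
  have summable := summable_norm_thetaTerm hp (norm_inv_ofReal_lt_one hq) hz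
  calc ‖qE q z‖ ≤ ∑' n : ℕ, ‖thetaTerm (q : ℂ)⁻¹ z n‖ := by
        rw [qE_eq_tsum_thetaTerm]
        exact norm_tsum_le_tsum_norm (summable.comp_injective Nat.cast_injective)
    _ ≤ ∑' n : ℤ, ‖thetaTerm (q : ℂ)⁻¹ z n‖ :=
        tsum_comp_le_tsum_of_inj summable (fun _ => norm_nonneg _) Nat.cast_injective
    _ = thetaSeries q⁻¹ ‖z‖ := tsum_congr norm_term

theorem exp_sq_log_rpow_div_mul_rpow (hq : 1 < q) (t α : ℝ) :
    Real.exp (Real.log (q ^ t) ^ 2 / (2 * Real.log q)) * (q ^ t) ^ α =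
      q ^ (t ^ 2 / 2 + α * t) := by
  have hq0 : 0 < q := zero_lt_one.trans hq
  have hlog : Real.log q ≠ 0 := (Real.log_pos hq).ne'
  rw [Real.log_rpow hq0, ← Real.rpow_mul hq0.le, Real.rpow_def_of_pos hq0,
    Real.rpow_def_of_pos hq0, ← Real.exp_add]
  congr 1
  field_simp

theorem periodic_thetaSeries_rpow_mul (hq : 0 < q) :
    Function.Periodic
      (fun t : ℝ => thetaSeries q⁻¹ (q ^ t) * q ^ (-(t ^ 2 / 2 + 1 / 2 * t))) 1 := by
  intro t
  have step := thetaSeries_zpow_mul (inv_ne_zero hq.ne') (Real.rpow_pos_of_pos hq (t + 1)).ne' 1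
  have point : q⁻¹ ^ (1 : ℤ) * q ^ (t + 1) = q ^ t := by
    rw [Real.rpow_add_one hq.ne']
    field_simp
  have term : thetaTerm q⁻¹ (q ^ (t + 1)) 1 = q ^ (t + 1) := by simp [thetaTerm]
  have exponent : -(t ^ 2 / 2 + 1 / 2 * t) =
      t + 1 + -((t + 1) ^ 2 / 2 + 1 / 2 * (t + 1)) := by ring
  rw [point, term] at step
  simp only
  rw [← step, exponent, Real.rpow_add hq (t + 1), mul_assoc]

theorem isGrowthExponent_half (hq : 1 < q) : IsGrowthExponent q (1 / 2) := by
  have hq0 : 0 < q := zero_lt_one.trans hq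
  have continuous : Continuous
      fun t : ℝ => thetaSeries q⁻¹ (q ^ t) * q ^ (-(t ^ 2 / 2 + 1 / 2 * t)) := by
    have hp1 : ‖q⁻¹‖ < 1 := by
      rw [norm_inv, Real.norm_of_nonneg hq0.le]
      exact inv_lt_one_of_one_lt₀ hq
    have rpow : Continuous fun t : ℝ => q ^ t := Real.continuous_const_rpow hq0.ne'
    refine .mul ?_ (rpow.comp (by fun_prop))
    exact (continuousOn_thetaSeries (inv_ne_zero hq0.ne') hp1).comp_continuous rpow
      fun t => (Real.rpow_pos_of_pos hq0 t).ne'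
  obtain ⟨K, hK0, hK⟩ := ((periodic_thetaSeries_rpow_mul hq0).isBounded_of_continuous one_ne_zero
    continuous).exists_pos_norm_le
  refine ⟨K, hK0, fun z hz => (norm_qE_le_thetaSeries hq hz).trans ?_⟩
  obtain ⟨t, ht⟩ : ∃ t : ℝ, q ^ t = ‖z‖ :=
    ⟨Real.logb q ‖z‖, Real.rpow_logb hq0 hq.ne' (norm_pos_iff.2 hz)⟩
  have bound : thetaSeries q⁻¹ (q ^ t) * q ^ (-(t ^ 2 / 2 + 1 / 2 * t)) ≤ K :=
    (le_abs_self _).trans (hK _ ⟨t, rfl⟩)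
  rw [Real.rpow_neg hq0.le, ← div_eq_mul_inv, div_le_iff₀ (Real.rpow_pos_of_pos hq0 _)] at bound
  rwa [← ht, mul_assoc, exp_sq_log_rpow_div_mul_rpow hq]

theorem thetaTerm_le_norm_qE (hq : 1 < q) {r : ℝ} (hr : 0 < r) (n : ℕ) :
    thetaTerm q⁻¹ r n ≤ ‖qE q r‖ := by
  have hp : 0 < q⁻¹ := inv_pos.2 (zero_lt_one.trans hq)
  have summable : Summable fun n : ℕ => thetaTerm q⁻¹ r n :=
    .of_norm <| summable_norm_thetaTerm_natCast hp.ne'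
      ((Real.norm_of_nonneg hp.le).trans_lt (inv_lt_one_of_one_lt₀ hq)) hr.ne'
  have series : qE q r = (∑' n : ℕ, thetaTerm q⁻¹ r n : ℝ) := by
    rw [qE_eq_tsum_thetaTerm, Complex.ofReal_tsum]
    simp [thetaTerm]
  rw [series, Complex.norm_real]
  exact (summable.le_tsum n fun k _ => thetaTerm_nonneg hp.le hr.le k).trans (le_abs_self _)

theorem thetaTerm_inv_pow_self (hq : 0 < q) (n : ℕ) :
    thetaTerm q⁻¹ (q ^ n) n = q ^ ((n : ℝ) ^ 2 / 2 + 1 / 2 * n) := by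
  rw [thetaTerm_natCast, ← pow_mul, inv_pow, ← Real.rpow_natCast, ← Real.rpow_natCast,
    ← Real.rpow_neg hq.le, ← Real.rpow_add hq, Nat.cast_choose_two]
  congr 1
  push_cast
  ring

theorem IsGrowthExponent.half_le {α : ℝ} (hq : 1 < q) (h : IsGrowthExponent q α) :
    1 / 2 ≤ α := by
  have hq0 : 0 < q := zero_lt_one.trans hq
  obtain ⟨K, -, hK⟩ := h
  have bound (n : ℕ) : (q ^ (1 / 2 - α)) ^ n ≤ K := by
    have hr : 0 < q ^ n := pow_pos hq0 n
    have exponent : (1 / 2 - α) * n =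
      (n : ℝ) ^ 2 / 2 + 1 / 2 * n - ((n : ℝ) ^ 2 / 2 + α * n) := by ring
    have test := (thetaTerm_le_norm_qE hq hr n).trans (hK _ (Complex.ofReal_ne_zero.2 hr.ne'))
    rw [Complex.norm_real, Real.norm_of_nonneg hr.le, thetaTerm_inv_pow_self hq0, mul_assoc,
      ← Real.rpow_natCast q n, exp_sq_log_rpow_div_mul_rpow hq,
      ← div_le_iff₀ (Real.rpow_pos_of_pos hq0 _), ← Real.rpow_sub hq0] at test
    rwa [← Real.rpow_natCast, ← Real.rpow_mul hq0.le, exponent]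
  by_contra! hα
  obtain ⟨n, hn⟩ := pow_unbounded_of_one_lt K (Real.one_lt_rpow hq (sub_pos.2 hα))
  exact (bound n).not_gt hn

theorem isLeast_isGrowthExponent (hq : 1 < q) : IsLeast {α | IsGrowthExponent q α} (1 / 2) :=
  ⟨isGrowthExponent_half hq, fun _ h => h.half_le hq⟩

end GrowthExponent

theorem proposition2_general (q : ℝ) (hq : 1 < q) :
    IsLeast {α | IsGrowthExponent q α} (1 / 2) ∧
    ∀ ω z : ℂ, 1 < ‖ω / z‖ →
      ∀ d : ℝ, (∀ k : ℤ, Complex.arg (ω / z) + d ≠ (2 * k + 1) * Real.pi) →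
        RayIntegrable d (fun ξ => qE q ξ / qTheta q (q * (ω * ξ / z))) ∧
        z / (ω - z) = (q : ℂ) / (Real.log q : ℂ) *
          rayIntegral d (fun ξ => qE q ξ / qTheta q (q * (ω * ξ / z))) := by
  refine ⟨isLeast_isGrowthExponent hq, fun ω z hl d hd => ?_⟩
  have hq0 : 0 < q := zero_lt_one.trans hq
  have hqC : (q : ℂ) ≠ 0 := Complex.ofReal_ne_zero.2 hq0.ne'
  have hlog : (Real.log q : ℂ) ≠ 0 := Complex.ofReal_ne_zero.2 (Real.log_pos hq).ne'
  have hl0 : ω / z ≠ 0 := norm_pos_iff.1 (zero_lt_one.trans hl)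
  have hz : z ≠ 0 := (div_ne_zero_iff.1 hl0).2
  have hs : q * (ω / z) * Complex.exp (d * Complex.I) ∈ Complex.slitPlane :=
    mul_exp_mem_slitPlane (mul_ne_zero hqC hl0) (by rwa [Complex.arg_real_mul _ hq0])
  simp only [mul_div_right_comm ω]
  refine ⟨rayIntegrable_qE_div_qTheta hq hl hs, ?_⟩
  rw [rayIntegral_qE_div_qTheta hq hl hs, div_sub_one hz, inv_div]
  field_simp

theorem proposition2 (q : ℝ) (hq : 1 < q) :
    (∃ α : ℝ, IsGrowthExponent q α) ∧
    ∀ α : ℝ, IsGrowthExponent q α →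
      ∀ ω z : ℂ, ω ≠ 0 → z ≠ 0 → ω ≠ z →
      ∀ d : ℝ, (∀ k : ℤ, Complex.arg (ω / z) + d ≠ (2 * k + 1) * Real.pi) →
        q ^ (α - 1 / 2) < ‖ω / z‖ →
        RayIntegrable d (fun ξ => qE q ξ / qTheta q (q * (ω * ξ / z))) ∧
        z / (ω - z) = (q : ℂ) / (Real.log q : ℂ) *
          rayIntegral d (fun ξ => qE q ξ / qTheta q (q * (ω * ξ / z))) := by
  obtain ⟨least, formula⟩ := proposition2_general q hq
  exact ⟨⟨_, least.1⟩, fun α hα ω z _ _ _ d hd h =>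
    formula ω z ((Real.one_le_rpow hq.le (sub_nonneg.2 (least.2 hα))).trans_lt h) d hd⟩
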